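/- Let $E/\mathbb Q$ be an elliptic curve. For $m\ge 1$ let $\mathbb Q(E[m])\subseteq\overline{\mathbb Q}$ denote the $m$-division field of $E$, i.e. the field generated over $\mathbb Q$ by the coordinates of all points $P\in E(\overline{\mathbb Q})$ with $mP=\mathcal O$. (1) Let $p>2$ be a prime, $n\geq 1$ and $k\in\{1,2,3,4\}$. If $p^k$ divides $[\mathbb Q(E[p^{n+1}]):\mathbb Q(E[p^n])]$, then $p^k$ divides $[\mathbb Q(E[p^{n+2}]):\mathbb Q(E[p^{n+1}])]$. (2) Let $n\geq 2$ and $k\in\{1,2,3,4\}$. If $2^k$ divides $[\mathbb Q(E[2^{n+1}]):\mathbb Q(E[2^n])]$, then $2^k$ divides $[\mathbb Q(E[2^{n+2}]):\mathbb Q(E[2^{n+1}])]$. -/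

import Mathlib

open Classical in
/-- The division field `F(E[m])`: the subfield of the algebraic closure of `F` generated over `F` by
the coordinates of all affine points `P = (x, y)` of `E` over the algebraic closure with
`m • P = 0` (the point at infinity has no affine coordinates). -/
noncomputable def divisionField {F : Type*} [Field F] (E : WeierstrassCurve F) (m : ℕ) :
    IntermediateField F (AlgebraicClosure F) :=
  IntermediateField.adjoin F
    {z | ∃ (x y : AlgebraicClosure F)
      (h : (E.baseChange (AlgebraicClosure F)).toAffine.Nonsingular x y),
      m • WeierstrassCurve.Affine.Point.some x y h = 0 ∧ (z = x ∨ z = y)}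

open Classical in
/-- `F(E[m]) ⊆ F(E[m'])` whenever `m` divides `m'`. -/
theorem divisionField_le_of_dvd {F : Type*} [Field F] (E : WeierstrassCurve F) {m m' : ℕ}
    (hm : m ∣ m') : divisionField E m ≤ divisionField E m' := by
  obtain ⟨c, rfl⟩ := hm
  refine IntermediateField.adjoin.mono _ _ _ ?_
  rintro z ⟨x, y, h, h0, hz⟩
  refine ⟨x, y, h, ?_, hz⟩
  rw [mul_nsmul, h0, nsmul_zero]

/-- The relative degree `[F(E[b]) : F(E[a])]`, used for `a ∣ b`, when
`F(E[a]) ⊆ F(E[b])` (see `divisionField_le_of_dvd`). -/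
noncomputable def divisionFieldDegree {F : Type*} [Field F] (E : WeierstrassCurve F)
    (b a : ℕ) : ℕ :=
  IntermediateField.relfinrank (divisionField E a) (divisionField E b)

/-- For `a ∣ b` this is the dimension of `F(E[b])` as a vector space over `F(E[a])`. -/
theorem divisionFieldDegree_eq_finrank {F : Type*} [Field F] (E : WeierstrassCurve F) {a b : ℕ}
    (h : a ∣ b) :
    divisionFieldDegree E b a =
      Module.finrank (divisionField E a)
        (IntermediateField.extendScalars (divisionField_le_of_dvd E h)) :=
  IntermediateField.relfinrank_eq_finrank_of_le (divisionField_le_of_dvd E h)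

/-! Let `H n` be the group of Galois automorphisms acting trivially on the `p ^ n`-torsion; by
Galois theory the degrees are the indices of successive `H n`. For `σ` in `H n` and `N = σ - 1`,
binomial expansion on the `p ^ (n + 2)`-torsion gives `σ ^ p = 1 + p N` (`pow_prime_apply`). Hence
`σ ↦ σ ^ p` induces a homomorphism from `H n / H (n + 1)` to `H (n + 1) / H (n + 2)`. It is
injective because the group of points is `p`-divisible, so one degree divides the next
(`relIndex_torsionFixer_dvd`). Divisibility (`exists_nsmul_eq`) comes from writing the
`x`-coordinate of `n • P` as `A / B` with `deg A > deg B`: then `A - u B` has a root for every `u`.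
-/

namespace Polynomial

variable {R : Type*} [CommRing R]

/-- The polynomial `p` has degree at most `d` and its coefficient of degree `d` is `a`. -/
structure HasTop (p : R[X]) (d : ℕ) (a : R) : Prop where
  natDegree_le : p.natDegree ≤ d
  coeff_eq : p.coeff d = a

namespace HasTop

variable {p q : R[X]} {d e : ℕ} {a b : R}

theorem mul (hp : HasTop p d a) (hq : HasTop q e b) : HasTop (p * q) (d + e) (a * b) :=
  ⟨natDegree_mul_le_of_le hp.1 hq.1,
    by rw [coeff_mul_add_eq_of_natDegree_le hp.1 hq.1, hp.2, hq.2]⟩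

theorem pow_two (hp : HasTop p d a) : HasTop (p ^ 2) (d + d) (a * a) :=
  sq p ▸ hp.mul hp

theorem sub (hp : HasTop p d a) (hq : HasTop q d b) : HasTop (p - q) d (a - b) :=
  ⟨(natDegree_sub_le_iff_left hq.1).mpr hp.1, by rw [coeff_sub, hp.2, hq.2]⟩

theorem add (hp : HasTop p d a) (hq : HasTop q d b) : HasTop (p + q) d (a + b) :=
  ⟨natDegree_add_le_of_degree_le hp.1 hq.1, by rw [coeff_add, hp.2, hq.2]⟩

theorem of_lt (hp : HasTop p d a) (h : d < e) : HasTop p e 0 :=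
  ⟨hp.1.trans h.le, coeff_eq_zero_of_natDegree_lt (hp.1.trans_lt h)⟩

theorem X : HasTop (X : R[X]) 1 1 := ⟨natDegree_X_le, coeff_X_one⟩

theorem C (a : R) : HasTop (C a) 0 a := ⟨(natDegree_C a).le, coeff_C_zero⟩

theorem natDegree_eq (hp : HasTop p d a) (ha : a ≠ 0) : p.natDegree = d :=
  natDegree_eq_of_le_of_coeff_ne_zero hp.1 (hp.2.symm ▸ ha)

theorem ne_zero (hp : HasTop p d a) (ha : a ≠ 0) : p ≠ 0 := by
  rintro rfl
  exact ha (by rw [← hp.2, coeff_zero])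

end HasTop

end Polynomial

/-! ### Multiplication by `n` on `x`-coordinates -/

namespace WeierstrassCurve.Affine.Point

open Polynomial

/-- Over an algebraically closed field, every `x` is the first coordinate of a point. -/
theorem exists_equation {K : Type*} [Field K] [CharZero K] [IsAlgClosed K]
    (W : WeierstrassCurve.Affine K) (x : K) : ∃ y, W.Equation x y := by
  obtain ⟨s, hs⟩ := IsAlgClosed.exists_pow_nat_eq
    (4 * x ^ 3 + W.b₂ * x ^ 2 + 2 * W.b₄ * x + W.b₆) two_pos
  refine ⟨(s - (W.a₁ * x + W.a₃)) / 2, (W.equation_iff _ _).mpr ?_⟩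
  simp only [b₂, b₄, b₆] at hs
  field_simp
  linear_combination hs

section Field

variable {K : Type*} [Field K] [DecidableEq K] {W : WeierstrassCurve.Affine K}

/-- The product of the `x`-coordinates of `P + Q` and `P - Q`. -/
theorem exists_add_sub_eq_some {x₁ y₁ x₂ y₂ : K} (h₁ : W.Nonsingular x₁ y₁)
    (h₂ : W.Nonsingular x₂ y₂) (hx : x₁ ≠ x₂) :
    ∃ (u v : K) (y : K) (h : W.Nonsingular u y) (z : K) (h' : W.Nonsingular v z),
      some x₁ y₁ h₁ + some x₂ y₂ h₂ = some u y h ∧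
      some x₁ y₁ h₁ - some x₂ y₂ h₂ = some v z h' ∧
      u * v * (x₁ - x₂) ^ 2 =
        (x₁ * x₂) ^ 2 - W.b₄ * (x₁ * x₂) - W.b₆ * (x₁ + x₂) - W.b₈ := by
  have hsub := (sub_eq_add_neg (some x₁ y₁ h₁) (some x₂ y₂ h₂)).trans
    (add_of_X_ne (h₁ := h₁) (h₂ := (nonsingular_neg ..).mpr h₂) hx)
  refine ⟨_, _, _, _, _, _, add_of_X_ne hx, hsub, ?_⟩
  have e₁ := (W.equation_iff x₁ y₁).mp h₁.1
  have e₂ := (W.equation_iff x₂ y₂).mp h₂.1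
  have hx' : x₁ - x₂ ≠ 0 := sub_ne_zero.mpr hx
  rw [slope_of_X_ne hx, slope_of_X_ne hx]
  simp only [addX, negY, b₄, b₆, b₈]
  generalize W.a₁ = a₁, W.a₂ = a₂, W.a₃ = a₃, W.a₄ = a₄, W.a₆ = a₆ at *
  -- The curve equation is linear in `a₆`, which can thus be eliminated.
  have ha : a₆ = y₂ ^ 2 + a₁ * x₂ * y₂ + a₃ * y₂ - (x₂ ^ 3 + a₂ * x₂ ^ 2 + a₄ * x₂) := by
    linear_combination -e₂
  clear hsub h₁ h₂
  field_simp
  grind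

/-- The duplication formula for `x`-coordinates. -/
theorem exists_two_nsmul_eq_some {x y : K} (h : W.Nonsingular x y)
    (hx : 4 * x ^ 3 + W.b₂ * x ^ 2 + 2 * W.b₄ * x + W.b₆ ≠ 0) :
    ∃ (u v : K) (h' : W.Nonsingular u v), 2 • some x y h = some u v h' ∧
      u * (4 * x ^ 3 + W.b₂ * x ^ 2 + 2 * W.b₄ * x + W.b₆) =
        x ^ 4 - W.b₄ * x ^ 2 - 2 * W.b₆ * x - W.b₈ := by
  have e := (W.equation_iff x y).mp h.1
  have hsq : (y - W.negY x y) ^ 2 = 4 * x ^ 3 + W.b₂ * x ^ 2 + 2 * W.b₄ * x + W.b₆ := by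
    simp only [negY, b₂, b₄, b₆]
    linear_combination 4 * e
  have hy' : y - W.negY x y ≠ 0 := fun h0 => hx (by rw [← hsq, h0]; ring)
  have hy : y ≠ W.negY x y := sub_ne_zero.mp hy'
  refine ⟨_, _, _, (two_nsmul _).trans (add_self_of_Y_ne hy), ?_⟩
  rw [← hsq, slope_of_Y_ne rfl hy]
  have hd : y - W.negY x y = y - (-y - W.a₁ * x - W.a₃) := rfl
  simp only [addX, b₄, b₆, b₈]
  generalize y - W.negY x y = d at *
  generalize W.a₁ = a₁, W.a₂ = a₂, W.a₃ = a₃, W.a₄ = a₄, W.a₆ = a₆ at *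
  have ha : a₆ = y ^ 2 + a₁ * x * y + a₃ * y - (x ^ 3 + a₂ * x ^ 2 + a₄ * x) := by
    linear_combination -e
  clear h hsq hx hy
  field_simp
  subst ha hd
  ring

/-- The `x`-coordinate of `n • P` is given off a finite set by the rational function `A / B`,
where `A` and `B` have leading terms `a X ^ (d + 1)` and `n ^ 2 a X ^ d`. -/
def IsNSMulX (W : WeierstrassCurve.Affine K) (n : ℕ) (A B : K[X]) : Prop :=
  (∃ (d : ℕ) (a : K), a ≠ 0 ∧ A.HasTop (d + 1) a ∧ B.HasTop d (n ^ 2 * a)) ∧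
  ∃ S : Set K, S.Finite ∧ ∀ (x y : K) (h : W.Nonsingular x y), x ∉ S →
    B.eval x ≠ 0 ∧ ∃ (z : K) (h' : W.Nonsingular (A.eval x / B.eval x) z),
      n • some x y h = some _ z h'

theorem isNSMulX_one : IsNSMulX W 1 X 1 := by
  refine ⟨⟨0, 1, one_ne_zero, HasTop.X, by simp, by simp⟩, ∅, Set.finite_empty, ?_⟩
  intro x y h _
  refine ⟨by simp, y, by simpa using h, ?_⟩
  simp

variable [CharZero K]

theorem isNSMulX_two : IsNSMulX W 2 (X ^ 4 - C W.b₄ * X ^ 2 - C (2 * W.b₆) * X - C W.b₈)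
    (C 4 * X ^ 3 + C W.b₂ * X ^ 2 + C (2 * W.b₄) * X + C W.b₆) := by
  have hX2 : HasTop (X ^ 2 : K[X]) 2 1 := by
    simpa using (HasTop.X (R := K)).pow_two
  have hX3 : HasTop (X ^ 3 : K[X]) 3 1 := by simpa [pow_succ] using hX2.mul HasTop.X
  have hX4 : HasTop (X ^ 4 : K[X]) 4 1 := by simpa [← pow_add, ← pow_mul] using hX2.pow_two
  have hA : HasTop (X ^ 4 - C W.b₄ * X ^ 2 - C (2 * W.b₆) * X - C W.b₈) (3 + 1) 1 := by
    simpa using ((hX4.sub (((HasTop.C W.b₄).mul hX2).of_lt (by norm_num))).sub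
      (((HasTop.C (2 * W.b₆)).mul HasTop.X).of_lt (by norm_num))).sub
      ((HasTop.C W.b₈).of_lt (by norm_num))
  have hB : HasTop (C 4 * X ^ 3 + C W.b₂ * X ^ 2 + C (2 * W.b₄) * X + C W.b₆) 3 4 := by
    have h3 := (HasTop.C (4 : K)).mul hX3
    rw [zero_add] at h3
    simpa using ((h3.add (((HasTop.C W.b₂).mul hX2).of_lt (by norm_num))).add
      (((HasTop.C (2 * W.b₄)).mul HasTop.X).of_lt (by norm_num))).add
      ((HasTop.C W.b₆).of_lt (by norm_num))
  refine ⟨⟨3, 1, one_ne_zero, hA, by convert hB using 1; norm_num⟩, _,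
    finite_setOfPred_isRoot (hB.ne_zero (by norm_num)), ?_⟩
  intro x y h hx
  have hx' : eval x (C 4 * X ^ 3 + C W.b₂ * X ^ 2 + C (2 * W.b₄) * X + C W.b₆) ≠ 0 := hx
  refine ⟨hx', ?_⟩
  have hBx : eval x (C 4 * X ^ 3 + C W.b₂ * X ^ 2 + C (2 * W.b₄) * X + C W.b₆) =
    4 * x ^ 3 + W.b₂ * x ^ 2 + 2 * W.b₄ * x + W.b₆ := by simp
  obtain ⟨u, v, h', h2, hu⟩ := exists_two_nsmul_eq_some h (hBx ▸ hx')
  have : eval x (X ^ 4 - C W.b₄ * X ^ 2 - C (2 * W.b₆) * X - C W.b₈) /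
      eval x (C 4 * X ^ 3 + C W.b₂ * X ^ 2 + C (2 * W.b₄) * X + C W.b₆) = u := by
    rw [div_eq_iff hx', hBx, hu]
    simp
  rw [this]
  exact ⟨v, h', h2⟩

/-- Apply `exists_add_sub_eq_some` to `(n + 1) • P` and `P`: their difference is `n • P`, so
dividing the product by its `x`-coordinate leaves that of `(n + 2) • P`. -/
theorem IsNSMulX.add_two {n : ℕ} (hn : 1 ≤ n) {A₁ B₁ A₂ B₂ : K[X]} (h₁ : IsNSMulX W n A₁ B₁)
    (h₂ : IsNSMulX W (n + 1) A₂ B₂) :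
    IsNSMulX W (n + 2)
      (((X * A₂) ^ 2 - (C W.b₄ * ((X * A₂) * B₂) + C W.b₆ * ((X * B₂ + A₂) * B₂) +
        C W.b₈ * B₂ ^ 2)) * B₁) ((X * B₂ - A₂) ^ 2 * A₁) := by
  obtain ⟨⟨d₁, a₁, ha₁, hA₁, hB₁⟩, S₁, hS₁, H₁⟩ := h₁
  obtain ⟨⟨d₂, a₂, ha₂, hA₂, hB₂⟩, S₂, hS₂, H₂⟩ := h₂
  have hn0 : (n : K) ≠ 0 := by exact_mod_cast (by omega : n ≠ 0)
  have hn2 : (n : K) + 2 ≠ 0 := by exact_mod_cast (by omega : n + 2 ≠ 0)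
  have hXA := HasTop.X.mul hA₂
  have hXB := HasTop.X.mul hB₂
  rw [add_comm 1 d₂] at hXB
  have hD := hXB.sub hA₂
  have hDne : (1 * (((n + 1 : ℕ) : K) ^ 2 * a₂) - a₂) ≠ 0 := by
    have : (1 * (((n + 1 : ℕ) : K) ^ 2 * a₂) - a₂) = n * (n + 2) * a₂ := by push_cast; ring
    rw [this]
    positivity
  have hL := ((((HasTop.C W.b₄).mul (hXA.mul hB₂)).of_lt
    (show _ < (1 + (d₂ + 1)) + (1 + (d₂ + 1)) by omega)).add
    (((HasTop.C W.b₆).mul ((hXB.add hA₂).mul hB₂)).of_lt (by omega))).add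
    (((HasTop.C W.b₈).mul hB₂.pow_two).of_lt (by omega))
  have hN := (hXA.pow_two.sub hL).mul hB₁
  refine ⟨⟨d₁ + 2 * d₂ + 3, n ^ 2 * a₂ ^ 2 * a₁, by positivity, ?_, ?_⟩, ?_⟩
  · convert hN using 1
    · omega
    · ring
  · convert hD.pow_two.mul hA₁ using 1
    · omega
    · push_cast; ring
  -- The new exceptions are `(n + 1) • P = ± P` and a zero `x`-coordinate of `n • P`.
  refine ⟨S₁ ∪ S₂ ∪ {x | (X * B₂ - A₂).IsRoot x} ∪ {x | A₁.IsRoot x},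
    ((hS₁.union hS₂).union (finite_setOfPred_isRoot (hD.ne_zero hDne))).union
      (finite_setOfPred_isRoot (hA₁.ne_zero ha₁)), ?_⟩
  intro x y h hx
  simp only [Set.mem_union, Set.mem_ofPred_eq, not_or, IsRoot.def] at hx
  obtain ⟨⟨⟨hx₁, hx₂⟩, hxD⟩, hxA⟩ := hx
  obtain ⟨hb₁, z₁, w₁, e₁⟩ := H₁ x y h hx₁
  obtain ⟨hb₂, z₂, w₂, e₂⟩ := H₂ x y h hx₂
  have hne : A₂.eval x / B₂.eval x ≠ x := by
    rw [Ne, div_eq_iff hb₂]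
    intro h0
    apply hxD
    simp [h0]
  obtain ⟨u, v, s, ws, t, wt, eadd, esub, huv⟩ := exists_add_sub_eq_some w₂ h hne
  rw [← e₂, ← succ_nsmul] at eadd
  rw [← e₂, succ_nsmul, add_sub_cancel_right, e₁, some.injEq] at esub
  have hBne : eval x ((X * B₂ - A₂) ^ 2 * A₁) ≠ 0 := by
    rw [eval_mul, eval_pow]
    exact mul_ne_zero (pow_ne_zero _ hxD) hxA
  refine ⟨hBne, ?_⟩
  have hu : eval x (((X * A₂) ^ 2 - (C W.b₄ * ((X * A₂) * B₂) + C W.b₆ * ((X * B₂ + A₂) * B₂) +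
        C W.b₈ * B₂ ^ 2)) * B₁) / eval x ((X * B₂ - A₂) ^ 2 * A₁) = u := by
    rw [div_eq_iff hBne]
    rw [← esub.1] at huv
    simp only [eval_mul, eval_sub, eval_add, eval_pow, eval_X, eval_C]
    field_simp at huv
    linear_combination -huv
  rw [hu]
  exact ⟨s, ws, eadd⟩

theorem exists_isNSMulX (W : WeierstrassCurve.Affine K) {n : ℕ} (hn : 1 ≤ n) :
    ∃ A B : K[X], IsNSMulX W n A B := by
  suffices (∃ A B : K[X], IsNSMulX W n A B) ∧ ∃ A B : K[X], IsNSMulX W (n + 1) A B from this.1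
  induction n, hn using Nat.le_induction with
  | base => exact ⟨⟨_, _, isNSMulX_one⟩, _, _, isNSMulX_two⟩
  | succ n hn ih =>
    obtain ⟨⟨A₁, B₁, h₁⟩, A₂, B₂, h₂⟩ := ih
    exact ⟨⟨A₂, B₂, h₂⟩, _, _, h₁.add_two hn h₂⟩

/-! ### Divisibility of the group of points -/

variable [IsAlgClosed K]

theorem exists_finite_forall_mem_range_nsmul (W : WeierstrassCurve.Affine K) [W.IsElliptic]
    {n : ℕ} (hn : 1 ≤ n) :
    ∃ U : Set K, U.Finite ∧ ∀ (u v : K) (h : W.Nonsingular u v), u ∉ U →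
      ∃ P : W.Point, n • P = some u v h := by
  obtain ⟨A, B, ⟨d, a, ha, hA, hB⟩, S, hS, H⟩ := exists_isNSMulX W hn
  have hn0 : (n : K) ≠ 0 := by exact_mod_cast (by omega : n ≠ 0)
  have hB0 : B ≠ 0 := hB.ne_zero (by positivity)
  -- The recursion may create common factors; removing them ensures that a root of `A' - u B'` is
  -- not a root of `B'`.
  obtain ⟨g, A', B', hco, rfl, rfl⟩ : ∃ g A' B' : K[X], IsCoprime A' B' ∧ A = g * A' ∧
      B = g * B' := by
    have hgcd := isCoprime_div_gcd_div_gcd (p := A) hB0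
    exact ⟨GCDMonoid.gcd A B, _, _, hgcd,
      (EuclideanDomain.mul_div_cancel' (gcd_ne_zero_of_right hB0) (gcd_dvd_left A B)).symm,
      (EuclideanDomain.mul_div_cancel' (gcd_ne_zero_of_right hB0) (gcd_dvd_right A B)).symm⟩
  have hg : g ≠ 0 := left_ne_zero_of_mul hB0
  have hdeg : B'.natDegree < A'.natDegree := by
    have h1 := hA.natDegree_eq ha
    have h2 := hB.natDegree_eq (by positivity)
    rw [natDegree_mul hg (right_ne_zero_of_mul (hA.ne_zero ha))] at h1
    rw [natDegree_mul hg (right_ne_zero_of_mul hB0)] at h2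
    omega
  refine ⟨(fun x => A'.eval x / B'.eval x) '' S, hS.image _, fun u v h hu => ?_⟩
  have hpos : (A' - C u * B').degree ≠ 0 := by
    have : (A' - C u * B').natDegree = A'.natDegree :=
      natDegree_sub_eq_left_of_natDegree_lt ((natDegree_C_mul_le u B').trans_lt hdeg)
    intro h0
    have h0' : (A' - C u * B').natDegree = 0 := natDegree_eq_of_degree_eq_some h0
    omega
  obtain ⟨x, hx⟩ := IsAlgClosed.exists_root _ hpos
  have hAB : A'.eval x = u * B'.eval x := by
    simpa [IsRoot, sub_eq_zero] using hx
  have hBx : B'.eval x ≠ 0 := by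
    intro h0
    obtain ⟨r, s, hrs⟩ := hco
    have := congrArg (eval x) hrs
    simp [hAB, h0] at this
  have hdiv : A'.eval x / B'.eval x = u := (div_eq_iff hBx).mpr hAB
  obtain ⟨y, hy⟩ := exists_equation W x
  obtain ⟨hb, z, w, e⟩ := H x y (W.equation_iff_nonsingular.mp hy) fun hxS => hu ⟨x, hxS, hdiv⟩
  have hgx : g.eval x ≠ 0 := by
    rw [eval_mul] at hb
    exact left_ne_zero_of_mul hb
  have hxu : eval x (g * A') / eval x (g * B') = u := by
    rw [eval_mul, eval_mul, mul_div_mul_left _ _ hgx, hdiv]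
  rcases X_eq_iff (h₁ := w) (h₂ := h) |>.mp hxu with h3 | h3
  · exact ⟨_, e.trans h3⟩
  · refine ⟨-some x y (W.equation_iff_nonsingular.mp hy), ?_⟩
    rw [smul_neg, e, h3, neg_neg]

/-- Multiplication by `n ≥ 1` is surjective on the points of an elliptic curve over an algebraically
closed field of characteristic zero. -/
theorem exists_nsmul_eq {W : WeierstrassCurve.Affine K} [W.IsElliptic] {n : ℕ} (hn : 1 ≤ n)
    (Q : W.Point) : ∃ P : W.Point, n • P = Q := by
  obtain ⟨U, hU, H⟩ := exists_finite_forall_mem_range_nsmul W hn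
  let Z : Set W.Point := ⋃ u ∈ U, {P | ∃ v h, P = some u v h}
  have hZ : Z.Finite := hU.biUnion fun u _ => by
    rcases Set.eq_empty_or_nonempty {P : W.Point | ∃ v h, P = some u v h} with h0 | ⟨P₀, hP₀⟩
    · exact h0 ▸ Set.finite_empty
    · refine Set.Finite.subset (Set.toFinite {P₀, -P₀}) ?_
      obtain ⟨v₀, h₀, rfl⟩ := hP₀
      rintro P ⟨v, h, rfl⟩
      exact X_eq_iff.mp rfl
  have key : ∀ R ∉ Z, ∃ P : W.Point, n • P = R := by
    rintro (_ | ⟨u, v, h⟩) hR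
    · exact ⟨0, smul_zero n⟩
    · exact H u v h fun hu => hR (Set.mem_biUnion hu ⟨v, h, rfl⟩)
  have hinf : Infinite W.Point := by
    choose y hy using exists_equation W
    refine Infinite.of_injective
      (fun x : K => some x (y x) (W.equation_iff_nonsingular.mp (hy x))) fun a b hab => ?_
    exact (some.inj hab).1
  -- Write `Q = R + (Q - R)` with both summands outside the finite exceptional set.
  obtain ⟨R, hR⟩ := (hZ.union (hZ.image fun R => Q - R)).exists_notMem
  rw [Set.mem_union, not_or] at hR
  obtain ⟨P₁, h₁⟩ := key R hR.1
  obtain ⟨P₂, h₂⟩ := key (Q - R) fun h => hR.2 ⟨_, h, sub_sub_cancel Q R⟩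
  exact ⟨P₁ + P₂, by rw [smul_add, h₁, h₂, add_sub_cancel]⟩

end Field

end WeierstrassCurve.Affine.Point

/-! ### Congruence subgroups of an abstract action -/

namespace AddMonoid.End

variable {G M : Type*} [Group G] [AddCommGroup M]

theorem hom_mul_apply (ρ : G →* AddMonoid.End M) (σ τ : G) (P : M) :
    ρ (σ * τ) P = ρ σ (ρ τ P) := by
  rw [map_mul]
  rfl

theorem hom_one_apply (ρ : G →* AddMonoid.End M) (P : M) : ρ 1 P = P := by
  rw [map_one]
  rfl

/-- The subgroup of elements acting trivially on the `m`-torsion. -/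
def torsionFixer (ρ : G →* AddMonoid.End M) (m : ℕ) : Subgroup G where
  carrier := {σ | ∀ P : M, m • P = 0 → ρ σ P = P}
  mul_mem' {σ τ} hσ hτ P hP := by rw [hom_mul_apply, hτ P hP, hσ P hP]
  one_mem' P _ := by rw [hom_one_apply]
  inv_mem' {σ} hσ P hP := by
    conv_lhs => rw [← hσ P hP]
    rw [← hom_mul_apply, inv_mul_cancel, hom_one_apply]

variable {ρ : G →* AddMonoid.End M}

theorem mem_torsionFixer {m : ℕ} {σ : G} :
    σ ∈ torsionFixer ρ m ↔ ∀ P : M, m • P = 0 → ρ σ P = P := Iff.rfl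

theorem inv_mul_mem_torsionFixer {m : ℕ} {σ τ : G} :
    σ⁻¹ * τ ∈ torsionFixer ρ m ↔ ∀ P : M, m • P = 0 → ρ τ P = ρ σ P := by
  refine forall₂_congr fun P _ => ?_
  have hinv (Q : M) : ρ σ⁻¹ (ρ σ Q) = Q := by
    rw [← hom_mul_apply, inv_mul_cancel, hom_one_apply]
  have hinv' (Q : M) : ρ σ (ρ σ⁻¹ Q) = Q := by
    rw [← hom_mul_apply, mul_inv_cancel, hom_one_apply]
  rw [hom_mul_apply]
  exact ⟨fun h => by rw [← h, hinv', h], fun h => by rw [h, hinv]⟩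

instance torsionFixer_normal (m : ℕ) : (torsionFixer ρ m).Normal where
  conj_mem σ hσ g P hP := by
    rw [hom_mul_apply, hom_mul_apply,
      hσ _ (by rw [← map_nsmul, hP, map_zero]), ← hom_mul_apply,
      mul_inv_cancel, hom_one_apply]

/-- With `N = σ - 1`, this is the expansion of `(1 + N) ^ k` truncated by `N ^ 3 P = 0`. -/
theorem pow_apply_eq_of_sub_fixed {σ : G} {P : M}
    (h : ρ σ (ρ σ (ρ σ P - P) - (ρ σ P - P)) = ρ σ (ρ σ P - P) - (ρ σ P - P)) (k : ℕ) :
    ρ (σ ^ k) P = P + k • (ρ σ P - P) + k.choose 2 • (ρ σ (ρ σ P - P) - (ρ σ P - P)) := by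
  induction k with
  | zero => simp
  | succ k ih =>
    rw [pow_succ', hom_mul_apply, ih, map_add, map_add, map_nsmul, map_nsmul, h,
      Nat.choose_succ_succ' k 1, Nat.choose_one_right]
    have h1 : ρ σ P = P + (ρ σ P - P) := by abel
    have h2 : ρ σ (ρ σ P - P) = (ρ σ P - P) + (ρ σ (ρ σ P - P) - (ρ σ P - P)) := by abel
    generalize ρ σ (ρ σ P - P) - (ρ σ P - P) = e at *
    generalize ρ σ P - P = d at *
    rw [h1, h2]
    module

variable {p n : ℕ}

theorem nsmul_sub_eq_zero {σ : G} (hσ : σ ∈ torsionFixer ρ (p ^ n)) {c : ℕ} {P : M}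
    (hP : (p ^ (n + c)) • P = 0) : p ^ c • (ρ σ P - P) = 0 := by
  rw [smul_sub, ← map_nsmul, hσ _ (by rw [← mul_nsmul', ← pow_add, hP]), sub_self]

theorem nsmul_pow_eq_zero_of_le {a b : ℕ} (hab : a ≤ b) {P : M} (hP : p ^ a • P = 0) :
    p ^ b • P = 0 := by
  rw [← Nat.sub_add_cancel hab, pow_add, mul_nsmul', hP, smul_zero]

theorem nsmul_sub_sub_eq_zero (hn : 1 ≤ n) {σ τ : G} (hσ : σ ∈ torsionFixer ρ (p ^ n))
    (hτ : τ ∈ torsionFixer ρ (p ^ n)) {P : M} (hP : (p ^ (n + 2)) • P = 0) :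
    p • (ρ τ (ρ σ P - P) - (ρ σ P - P)) = 0 := by
  have h := nsmul_sub_eq_zero hσ hP
  have h1 : p ^ (n + 1) • (ρ σ P - P) = 0 := nsmul_pow_eq_zero_of_le (by omega) h
  simpa using nsmul_sub_eq_zero hτ h1

theorem pow_prime_apply (hp : p.Prime) (hn : 1 ≤ n) (h2 : p = 2 → 2 ≤ n) {σ : G}
    (hσ : σ ∈ torsionFixer ρ (p ^ n)) {P : M} (hP : (p ^ (n + 2)) • P = 0) :
    ρ (σ ^ p) P = P + p • (ρ σ P - P) := by
  have h := nsmul_sub_sub_eq_zero hn hσ hσ hP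
  rw [pow_apply_eq_of_sub_fixed (hσ _ (nsmul_pow_eq_zero_of_le hn (by rwa [pow_one])))]
  -- The quadratic term must vanish. For odd `p`, `p` divides `p.choose 2` and kills `N ^ 2 P`; for
  -- `p = 2` the coefficient is 1, but `N P` is 4-torsion, hence fixed as `2 ≤ n`.
  rcases hp.eq_two_or_odd' with rfl | hodd
  · rw [hσ _ (nsmul_pow_eq_zero_of_le (h2 rfl) (nsmul_sub_eq_zero hσ hP)), sub_self, smul_zero,
      add_zero]
  · have h3 : 2 < p := lt_of_le_of_ne hp.two_le fun h0 => by
      rw [← h0] at hodd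
      exact absurd hodd (by decide)
    obtain ⟨c, hc⟩ := hp.dvd_choose_self two_ne_zero h3
    rw [hc, mul_nsmul, h, smul_zero, add_zero]

/-- Raising to the power `p` embeds the quotient of consecutive congruence subgroups in the next
one. -/
theorem relIndex_torsionFixer_dvd (hp : p.Prime) (hn : 1 ≤ n) (h2 : p = 2 → 2 ≤ n)
    (hdiv : ∀ Q : M, ∃ P : M, p • P = Q) :
    (torsionFixer ρ (p ^ (n + 1))).relIndex (torsionFixer ρ (p ^ n)) ∣
      (torsionFixer ρ (p ^ (n + 2))).relIndex (torsionFixer ρ (p ^ (n + 1))) := by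
  have hpow : ∀ σ ∈ torsionFixer ρ (p ^ n), σ ^ p ∈ torsionFixer ρ (p ^ (n + 1)) := by
    intro σ hσ P hP
    rw [pow_prime_apply hp hn h2 hσ (nsmul_pow_eq_zero_of_le (by omega) hP)]
    have := nsmul_sub_eq_zero hσ hP
    rw [pow_one] at this
    rw [this, add_zero]
  let f : torsionFixer ρ (p ^ n) →* torsionFixer ρ (p ^ (n + 1)) ⧸
      (torsionFixer ρ (p ^ (n + 2))).subgroupOf (torsionFixer ρ (p ^ (n + 1))) :=
    MonoidHom.mk' (fun σ => QuotientGroup.mk ⟨σ.1 ^ p, hpow σ.1 σ.2⟩) <| by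
      rintro ⟨σ, hσ⟩ ⟨τ, hτ⟩
      rw [← QuotientGroup.mk_mul, QuotientGroup.eq, Subgroup.mem_subgroupOf]
      refine inv_mul_mem_torsionFixer.mpr fun P hP => ?_
      change ρ (σ ^ p * τ ^ p) P = ρ ((σ * τ) ^ p) P
      rw [pow_prime_apply hp hn h2 (mul_mem hσ hτ) hP, hom_mul_apply,
        pow_prime_apply hp hn h2 hτ hP, map_add, pow_prime_apply hp hn h2 hσ hP]
      have hτP := nsmul_sub_eq_zero hτ hP
      rw [pow_mem hσ p (p • (ρ τ P - P)) (nsmul_pow_eq_zero_of_le hn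
        (by rwa [pow_one, ← mul_nsmul', ← sq]))]
      -- Multiplicativity: the cross term `(σ - 1)(τ - 1) P` is killed by `p`.
      have h := nsmul_sub_sub_eq_zero hn hτ hσ hP
      rw [map_sub, smul_sub, smul_sub, smul_sub, sub_eq_zero] at h
      rw [hom_mul_apply, smul_sub, smul_sub, smul_sub]
      rw [sub_eq_iff_eq_add] at h
      rw [h]
      abel
  have hker : f.ker = (torsionFixer ρ (p ^ (n + 1))).subgroupOf (torsionFixer ρ (p ^ n)) := by
    ext ⟨σ, hσ⟩
    rw [MonoidHom.mem_ker, Subgroup.mem_subgroupOf]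
    change (QuotientGroup.mk _ = 1) ↔ _
    rw [QuotientGroup.eq_one_iff, Subgroup.mem_subgroupOf]
    change (∀ P : M, _ → ρ (σ ^ p) P = P) ↔ ∀ P : M, _ → ρ σ P = P
    constructor
    · intro h Q hQ
      -- Divisibility makes every `p ^ (n + 1)`-torsion point `p` times a `p ^ (n + 2)`-torsion
      -- point.
      obtain ⟨P, rfl⟩ := hdiv Q
      have hP : p ^ (n + 2) • P = 0 := by rw [pow_succ, mul_nsmul', hQ]
      have := h P hP
      rw [pow_prime_apply hp hn h2 hσ hP, add_eq_left, smul_sub, sub_eq_zero] at this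
      rw [map_nsmul, this]
    · intro h P hP
      have := h (p • P) (by rw [← mul_nsmul', ← pow_succ, hP])
      rw [pow_prime_apply hp hn h2 hσ hP, add_eq_left, smul_sub, ← map_nsmul, this, sub_self]
  rw [Subgroup.relIndex, ← hker, Subgroup.index_ker, Subgroup.relIndex, Subgroup.index_eq_card]
  exact Subgroup.card_subgroup_dvd_card _

end AddMonoid.End

/-! ### Galois correspondence for division fields -/

namespace IntermediateField

variable {F L : Type*} [Field F] [Field L] [Algebra F L]

theorem relfinrank_eq_relIndex_fixingSubgroup [IsGalois F L] {A B : IntermediateField F L}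
    (h : A ≤ B) : relfinrank A B = B.fixingSubgroup.relIndex A.fixingSubgroup := by
  rw [relfinrank_eq_finrank_of_le h, IntermediateField.finrank_eq_fixingSubgroup_index, Subgroup.relIndex,
    ← Subgroup.index_comap_of_surjective _
      (f := (fixingSubgroupEquiv A).toMonoidHom) (fixingSubgroupEquiv A).surjective]
  congr 1

theorem mem_fixingSubgroup_adjoin_iff {S : Set L} {σ : Gal(L/F)} :
    σ ∈ (adjoin F S).fixingSubgroup ↔ ∀ x ∈ S, σ x = x := by
  rw [mem_fixingSubgroup_iff]
  refine ⟨fun h x hx => h x (subset_adjoin F S hx), fun h x hx => ?_⟩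
  induction hx using adjoin_induction with
  | mem x hx => exact h x hx
  | algebraMap x => exact σ.commutes x
  | add x y _ _ hx hy => rw [map_add, hx, hy]
  | inv x _ hx => rw [map_inv₀, hx]
  | mul x y _ _ hx hy => rw [map_mul, hx, hy]

end IntermediateField

open Classical in
/-- The Galois action on the points of `E` over the algebraic closure. -/
noncomputable def galoisActionOnPoints {F : Type*} [Field F] (E : WeierstrassCurve F) :
    Gal(AlgebraicClosure F/F) →*
      AddMonoid.End (E.baseChange (AlgebraicClosure F)).toAffine.Point where
  toFun σ := WeierstrassCurve.Affine.Point.map (W' := E) (σ : AlgebraicClosure F →ₐ[F] _)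
  map_one' := by
    ext P
    cases P <;> rfl
  map_mul' σ τ := by
    ext P
    cases P <;> rfl

open Classical in
theorem fixingSubgroup_divisionField {F : Type*} [Field F] (E : WeierstrassCurve F) (m : ℕ) :
    (divisionField E m).fixingSubgroup =
      AddMonoid.End.torsionFixer (galoisActionOnPoints E) m := by
  ext σ
  rw [divisionField, IntermediateField.mem_fixingSubgroup_adjoin_iff,
    AddMonoid.End.mem_torsionFixer]
  constructor
  · rintro h (_ | ⟨x, y, hxy⟩) hP
    · rfl
    · exact WeierstrassCurve.Affine.Point.some.injEq .. |>.mpr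
        ⟨h x ⟨x, y, hxy, hP, .inl rfl⟩, h y ⟨x, y, hxy, hP, .inr rfl⟩⟩
  · rintro h z ⟨x, y, hxy, hP, hz⟩
    have := WeierstrassCurve.Affine.Point.some.inj (h _ hP)
    rcases hz with rfl | rfl
    exacts [this.1, this.2]

theorem divisionFieldDegree_dvd {F : Type*} [Field F] [CharZero F] (E : WeierstrassCurve F)
    [E.IsElliptic] {p n : ℕ} (hp : p.Prime) (hn : 1 ≤ n) (h2 : p = 2 → 2 ≤ n) :
    divisionFieldDegree E (p ^ (n + 1)) (p ^ n) ∣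
      divisionFieldDegree E (p ^ (n + 2)) (p ^ (n + 1)) := by
  classical
  rw [divisionFieldDegree, divisionFieldDegree,
    IntermediateField.relfinrank_eq_relIndex_fixingSubgroup
      (divisionField_le_of_dvd E (pow_dvd_pow p n.le_succ)),
    IntermediateField.relfinrank_eq_relIndex_fixingSubgroup
      (divisionField_le_of_dvd E (pow_dvd_pow p (n + 1).le_succ)),
    fixingSubgroup_divisionField, fixingSubgroup_divisionField, fixingSubgroup_divisionField]
  have : CharZero (AlgebraicClosure F) := charZero_of_injective_algebraMap
    (algebraMap F (AlgebraicClosure F)).injective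
  have : WeierstrassCurve.IsElliptic (E.baseChange (AlgebraicClosure F)).toAffine :=
    inferInstanceAs (WeierstrassCurve.IsElliptic (E.map _))
  exact AddMonoid.End.relIndex_torsionFixer_dvd hp hn h2 fun Q => by
    convert WeierstrassCurve.Affine.Point.exists_nsmul_eq hp.one_le Q

theorem mainTheorem11 (E : WeierstrassCurve ℚ) [E.IsElliptic] :
    (∀ p n k : ℕ, p.Prime → 2 < p → 1 ≤ n → k ∈ ({1, 2, 3, 4} : Set ℕ) →
      p ^ k ∣ divisionFieldDegree E (p ^ (n + 1)) (p ^ n) →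
      p ^ k ∣ divisionFieldDegree E (p ^ (n + 2)) (p ^ (n + 1))) ∧
    (∀ n k : ℕ, 2 ≤ n → k ∈ ({1, 2, 3, 4} : Set ℕ) →
      2 ^ k ∣ divisionFieldDegree E (2 ^ (n + 1)) (2 ^ n) →
      2 ^ k ∣ divisionFieldDegree E (2 ^ (n + 2)) (2 ^ (n + 1))) :=
  ⟨fun _ _ _ hp h2 hn _ h => h.trans (divisionFieldDegree_dvd E hp hn fun h0 => by omega),
    fun _ _ hn _ h => h.trans
      (divisionFieldDegree_dvd E Nat.prime_two (one_le_two.trans hn) fun _ => hn)⟩
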